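/- **Setting.** A *triangulated tensor category* is a triangulated category $\mathcal C$ with suspension $T$ that is also an additive monoidal category $(\mathcal C,\otimes,e,\mathfrak a,\mathfrak l,\mathfrak r)$ (with $\otimes$ additive in each variable; no symmetry and no exactness of $\otimes$ is assumed), together with isomorphisms of bifunctors $\lambda: x\otimes T(y)\to T(x\otimes y)$ and $\rho: T(x)\otimes y\to T(x\otimes y)$ such that $T(\mathfrak l_x)\circ\lambda_{e,x}=\mathfrak l_{T(x)}$, $T(\mathfrak r_x)\circ\rho_{x,e}=\mathfrak r_{T(x)}$ and $T(\lambda_{x,y})\circ\rho_{x,T(y)}=-\,T(\rho_{x,y})\circ\lambda_{T(x),y}$. An *action* of $\mathcal C$ on a triangulated category $(\mathcal A,\Sigma)$ is a biadditive functor $*:\mathcal C\times\mathcal A\to\mathcal A$ with natural isomorphisms $(x\otimes y)*a\to x*(y*a)$ and $\mathfrak l'_a: e*a\to a$ satisfying the usual pentagon and the two unit triangles, together with isomorphisms of bifunctors $\lambda': x*\Sigma(a)\to\Sigma(x*a)$ and $\rho': T(x)*a\to\Sigma(x*a)$ such that $\Sigma(\mathfrak l'_a)\circ\lambda'_{e,a}=\mathfrak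 l'_{\Sigma(a)}$ and $\Sigma(\lambda'_{x,a})\circ\rho'_{x,\Sigma(a)}=-\,\Sigma(\rho'_{x,a})\circ\lambda'_{T(x),a}$. For $p\in\mathbb Z$ let $\rho'_p: T^p(x)*a\to\Sigma^p(x*a)$ be the isomorphism obtained by iterating $\rho'$. Let $\operatorname{Hom}^*_{\mathcal A}(a,b)=\bigoplus_{p\in\mathbb Z}\operatorname{Hom}_{\mathcal A}(a,\Sigma^p b)$, and let $\operatorname{End}^*_{\mathcal C}(e)=\bigoplus_{p\in\mathbb Z}\operatorname{Hom}_{\mathcal C}(e,T^p e)$ be the graded ring with product $h\cdot h'=T^q(h)\circ h'$ for $h'$ of degree $q$. It acts on $\operatorname{Hom}^*_{\mathcal A}(a,b)$ from the left through the homomorphism of graded rings $\operatorname{End}^*_{\mathcal C}(e)\to\operatorname{End}^*_{\mathcal A}(b)$ sending $h: e\to T^p e$ to $b\xrightarrow{\mathfrak l'^{-1}}e*b\xrightarrow{h*1}T^p(e)*b\xrightarrow{\rho'_p}\Sigma^p(e*b)\xrightarrow{\Sigma^p(\mathfrak l')}\Sigma^p(b)$. Let $H=\bigoplus_{n\ge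 0}H^n$ be a graded-commutative ring (that is, $xy=(-1)^{mn}yx$ for $x\in H^m$, $y\in H^n$), and let $\operatorname{Spec}H$ be the set of its homogeneous prime ideals. For an $H$-module $M$ let $\operatorname{Supp}M=\{\mathfrak p\in\operatorname{Spec}H: M_{\mathfrak p}\ne0\}$, where $M_{\mathfrak p}$ is the localization at the homogeneous elements of $H$ outside $\mathfrak p$. Given a homomorphism of graded rings $H\to\operatorname{End}^*_{\mathcal C}(e)$, the *support variety* of an object $a$ of $\mathcal A$ is $V(a)=\operatorname{Supp}\operatorname{Hom}^*_{\mathcal A}(a,a)$. A *closed homogeneous subvariety* of $V(a)$ is a subset of $V(a)$ of the form $V(I)=\operatorname{Supp}(H/I)$ with $I$ a homogeneous ideal of $H$. **Theorem.** Let $\mathcal C$ be a triangulated tensor category acting on a small triangulated category $\mathcal A$, and let $H$ be a non-negatively graded, graded-commutative Noetherian ring with a homomorphism of graded rings $H\to\operatorname{End}^*_{\mathcal C}(e)$ such that the left $H$-module $\operatorname{Hom}^*_{\mathcal A}(a,b)$ is finitely generated for all objects $a,b$ of $\mathcal A$. (a) For every object $a$ of $\mathcal A$ and every closed homogeneous subvariety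 $Z$ of $V(a)$ there is an object $b$ of $\mathcal A$ with $V(b)=Z$. (b) If $g$ is an object of $\mathcal A$ with $\mathcal A=\operatorname{Thick}(g)$, the smallest full triangulated subcategory containing $g$ and closed under direct summands, then for every closed homogeneous subvariety $Z$ of $V(g)$ there is an object $b$ of $\mathcal A$ with $V(b)=Z$. -/

import Mathlib

open CategoryTheory CategoryTheory.Limits CategoryTheory.MonoidalCategory
open scoped DirectSum CategoryTheory.MonoidalCategory.MonoidalLeftAction

/-! ### Bifunctors compatible with suspensions, tensor categories and actions -/

section Bifunctor

variable {C₁ C₂ D : Type*} [Category* C₁] [Category* C₂] [Category* D]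
  [HasShift C₁ ℤ] [HasShift C₂ ℤ] [HasShift D ℤ] [Preadditive D]

/-- A bifunctor `G(-,-)` together with isomorphisms of bifunctors
`lam : G(x, T y) ≅ T G(x, y)` and `rho : G(T x, y) ≅ T G(x, y)` such that the square
comparing the two isomorphisms `G(T x, T y) ≅ T² G(x, y)` anti-commutes.

Suspensions are ℤ-indexed families of shifts in Mathlib, so `lam` and `rho` are recorded, for a
fixed first, resp. second, variable, as `Functor.CommShift` structures. Such a structure is
determined by its component at `1` (the components at `p` and `-p` being the iterates of this
isomorphism and their inverses) and exists for every choice of this component. -/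
class SuspensionBifunctor (G : C₁ ⥤ C₂ ⥤ D) where
  /-- The isomorphisms `lam`, natural in the second variable. -/
  lam (x : C₁) : (G.obj x).CommShift ℤ
  /-- The isomorphisms `rho`, natural in the first variable. -/
  rho (y : C₂) : (G.flip.obj y).CommShift ℤ
  /-- `lam` is natural in the first variable. -/
  lam_naturality {x x' : C₁} (f : x ⟶ x') : NatTrans.CommShift (G.map f) ℤ
  /-- `rho` is natural in the second variable. -/
  rho_naturality {y y' : C₂} (g : y ⟶ y') : NatTrans.CommShift (G.flip.map g) ℤ
  anticomm (x : C₁) (y : C₂) :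
    ((G.obj (x⟦(1 : ℤ)⟧)).commShiftIso (1 : ℤ)).hom.app y ≫
        (((G.flip.obj y).commShiftIso (1 : ℤ)).hom.app x)⟦(1 : ℤ)⟧' =
      -(((G.flip.obj (y⟦(1 : ℤ)⟧)).commShiftIso (1 : ℤ)).hom.app x ≫
        (((G.obj x).commShiftIso (1 : ℤ)).hom.app y)⟦(1 : ℤ)⟧')

attribute [reducible] SuspensionBifunctor.lam SuspensionBifunctor.rho
attribute [instance] SuspensionBifunctor.lam SuspensionBifunctor.rho
  SuspensionBifunctor.lam_naturality SuspensionBifunctor.rho_naturality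

end Bifunctor

/-- The compatibility of the tensor product and the triangulation of a triangulated tensor
category. No exactness of the tensor product is required. -/
class TriangulatedTensorCategory (C : Type*) [Category* C] [Preadditive C] [HasZeroObject C]
    [HasShift C ℤ] [∀ n : ℤ, (shiftFunctor C n).Additive] [Pretriangulated C] [IsTriangulated C]
    [MonoidalCategory C] extends MonoidalPreadditive C, SuspensionBifunctor (curriedTensor C) where
  lam_unit (x : C) :
    (((curriedTensor C).obj (𝟙_ C)).commShiftIso (1 : ℤ)).hom.app x ≫ ((λ_ x).hom)⟦(1 : ℤ)⟧' =
      (λ_ (x⟦(1 : ℤ)⟧)).hom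
  rho_unit (x : C) :
    (((curriedTensor C).flip.obj (𝟙_ C)).commShiftIso (1 : ℤ)).hom.app x ≫
      ((ρ_ x).hom)⟦(1 : ℤ)⟧' = (ρ_ (x⟦(1 : ℤ)⟧)).hom

/-- The compatibility of an action `x ⊙ₗ a` of a tensor category `C` on a category `A` with
the triangulated structures of `C` and `A`. -/
class TriangulatedAction (C A : Type*) [Category* C] [Preadditive C] [HasShift C ℤ]
    [MonoidalCategory C]
    [Category* A] [Preadditive A] [HasZeroObject A] [HasShift A ℤ]
    [∀ n : ℤ, (shiftFunctor A n).Additive] [Pretriangulated A] [IsTriangulated A]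
    [MonoidalLeftAction C A] extends
    SuspensionBifunctor (MonoidalLeftAction.curriedAction C A) where
  add_right (x : C) {a b : A} (f g : a ⟶ b) : x ⊴ₗ (f + g) = x ⊴ₗ f + x ⊴ₗ g
  add_left {x y : C} (f g : x ⟶ y) (a : A) : (f + g) ⊵ₗ a = f ⊵ₗ a + g ⊵ₗ a
  lam_unit (a : A) :
    (((MonoidalLeftAction.curriedAction C A).obj (𝟙_ C)).commShiftIso (1 : ℤ)).hom.app a ≫
      ((λₗ[C] a).hom)⟦(1 : ℤ)⟧' = (λₗ[C] (a⟦(1 : ℤ)⟧)).hom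

/-! ### Graded morphism groups -/

section GradedHom

variable {D : Type*} [Category* D] [HasShift D ℤ]

/-- The degree `p` part `Hom(X, Σ^p Y)` of `Hom^*(X, Y)`. -/
def GHom (X Y : D) (p : ℤ) : Type _ := ShiftedHom X Y p

namespace GHom

theorem mk_comp_eq {X Y Z : D} {p q r s : ℤ} (f : ShiftedHom X Y q) (g : ShiftedHom Y Z p)
    (h : p + q = r) (h' : p + q = s) :
    (⟨r, f.comp g h⟩ : GradedMonoid (GHom X Z)) = ⟨s, f.comp g h'⟩ := by
  subst h; subst h'; rfl

/-- The product `g · f = Σ^q(g) ∘ f` of `g : Y ⟶ Σ^p Z` and `f : X ⟶ Σ^q Y`. -/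
noncomputable def mul {X Y Z : D} {p q : ℤ} (g : GHom Y Z p) (f : GHom X Y q) :
    GHom X Z (p + q) :=
  ShiftedHom.comp f g rfl

/-- The identity of `X` in degree `0`. -/
noncomputable def one (X : D) : GHom X X 0 := ShiftedHom.mk₀ (0 : ℤ) rfl (𝟙 X)

theorem one_mul {X Y : D} {q : ℤ} (f : GHom X Y q) :
    (⟨0 + q, mul (one Y) f⟩ : GradedMonoid (GHom X Y)) = ⟨q, f⟩ := by
  refine (mk_comp_eq f (one Y) rfl (zero_add q)).trans ?_
  exact congrArg (Sigma.mk q) (ShiftedHom.comp_mk₀_id f (0 : ℤ) rfl)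

theorem mul_one {X Y : D} {q : ℤ} (f : GHom X Y q) :
    (⟨q + 0, mul f (one X)⟩ : GradedMonoid (GHom X Y)) = ⟨q, f⟩ := by
  refine (mk_comp_eq (one X) f rfl (add_zero q)).trans ?_
  exact congrArg (Sigma.mk q) (ShiftedHom.mk₀_id_comp (0 : ℤ) rfl f)

theorem mul_assoc {X Y Z W : D} {p q r : ℤ} (h : GHom Z W p) (g : GHom Y Z q) (f : GHom X Y r) :
    (⟨p + q + r, mul (mul h g) f⟩ : GradedMonoid (GHom X W)) =
      ⟨p + (q + r), mul h (mul g f)⟩ := by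
  refine (congrArg (Sigma.mk (p + q + r))
    (ShiftedHom.comp_assoc f g h rfl rfl rfl).symm).trans ?_
  exact mk_comp_eq _ h _ rfl

end GHom

variable [Preadditive D]

instance (X Y : D) (p : ℤ) : AddCommGroup (GHom X Y p) :=
  inferInstanceAs (AddCommGroup (X ⟶ Y⟦p⟧))

/-- `Hom^*(X, Y)`, the direct sum of all `Hom(X, Σ^p Y)`. -/
abbrev HomStar (X Y : D) : Type _ := ⨁ p : ℤ, GHom X Y p

/-- `End^*(X) = Hom^*(X, X)`. -/
abbrev EndStar (X : D) : Type _ := HomStar X X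

namespace GHom

variable [∀ n : ℤ, (shiftFunctor D n).Additive]

noncomputable instance (X : D) : GradedMonoid.GOne (GHom X X) := ⟨one X⟩

noncomputable instance (X : D) : GradedMonoid.GMul (GHom X X) := ⟨fun g f => mul g f⟩

noncomputable instance (X : D) : DirectSum.GRing (GHom X X) where
  mul_zero g := ShiftedHom.zero_comp X _ g rfl
  zero_mul f := ShiftedHom.comp_zero X f rfl
  mul_add g f f' := ShiftedHom.add_comp f f' g rfl
  add_mul g g' f := ShiftedHom.comp_add f g g' rfl
  one_mul f := one_mul f.2
  mul_one f := mul_one f.2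
  mul_assoc h g f := mul_assoc h.2 g.2 f.2
  natCast n := n • one X
  natCast_zero := zero_nsmul _
  natCast_succ n := succ_nsmul _ n
  intCast n := n • one X
  intCast_ofNat n := natCast_zsmul _ n
  intCast_negSucc_ofNat n := negSucc_zsmul _ n

/-- `Hom^*(X, Y)` is a graded left `End^*(Y)`-module. -/
noncomputable instance (X Y : D) : DirectSum.Gmodule (GHom Y Y) (GHom X Y) where
  smul g f := mul g f
  smul_add g f f' := ShiftedHom.add_comp f f' g rfl
  smul_zero g := ShiftedHom.zero_comp X _ g rfl
  add_smul g g' f := ShiftedHom.comp_add f g g' rfl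
  zero_smul f := ShiftedHom.comp_zero Y f rfl
  one_smul f := one_mul f.2
  mul_smul h g f := mul_assoc h.2 g.2 f.2

end GHom

end GradedHom

/-! ### The central action of `End^*_C(e)` -/

section CentralAction

variable {C A : Type*} [Category* C] [Preadditive C] [HasShift C ℤ] [MonoidalCategory C]
  [Category* A] [Preadditive A] [HasZeroObject A] [HasShift A ℤ]
  [∀ n : ℤ, (shiftFunctor A n).Additive] [Pretriangulated A] [IsTriangulated A]
  [MonoidalLeftAction C A] [TriangulatedAction C A]

/-- For `h : e ⟶ T^p e` and `a : A` the composite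
`a ≅ e ⊙ₗ a ⟶ (T^p e) ⊙ₗ a ≅ Σ^p (e ⊙ₗ a) ≅ Σ^p a`, that is, the morphism `h · 1_a`. -/
noncomputable def centralHom (a : A) {p : ℤ} (h : ShiftedHom (𝟙_ C) (𝟙_ C) p) :
    ShiftedHom a a p :=
  (λₗ[C] a).inv ≫ h ⊵ₗ a ≫
    (((MonoidalLeftAction.curriedAction C A).flip.obj a).commShiftIso p).hom.app (𝟙_ C) ≫
      ((λₗ[C] a).hom)⟦p⟧'

theorem centralHom_eq (a : A) {p : ℤ} (h : ShiftedHom (𝟙_ C) (𝟙_ C) p) :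
    centralHom a h = (λₗ[C] a).inv ≫
      ShiftedHom.map h ((MonoidalLeftAction.curriedAction C A).flip.obj a) ≫
        ((λₗ[C] a).hom)⟦p⟧' :=
  congrArg ((λₗ[C] a).inv ≫ ·) (Category.assoc _ _ _).symm

theorem centralHom_one (a : A) :
    centralHom a (ShiftedHom.mk₀ (0 : ℤ) rfl (𝟙 (𝟙_ C))) = ShiftedHom.mk₀ (0 : ℤ) rfl (𝟙 a) := by
  have key : ∀ {x y : A} (l : x ≅ y),
      l.inv ≫ ShiftedHom.mk₀ (0 : ℤ) rfl (𝟙 x) ≫ l.hom⟦(0 : ℤ)⟧' =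
        ShiftedHom.mk₀ (0 : ℤ) rfl (𝟙 y) := by
    intro x y l
    have := (shiftFunctorZero' A (0 : ℤ) rfl).inv.naturality l.hom
    dsimp at this
    simp [ShiftedHom.mk₀, ← this]
  rw [centralHom_eq, ShiftedHom.map_mk₀, CategoryTheory.Functor.map_id]
  exact key _

theorem centralHom_comp (a : A) {p q r : ℤ} (f : ShiftedHom (𝟙_ C) (𝟙_ C) q)
    (g : ShiftedHom (𝟙_ C) (𝟙_ C) p) (hr : p + q = r) :
    centralHom a (f.comp g hr) = (centralHom a f).comp (centralHom a g) hr := by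
  have key : ∀ {x y : A} (l : x ≅ y) (u : ShiftedHom x x q) (v : ShiftedHom x x p),
      l.inv ≫ ShiftedHom.comp u v hr ≫ l.hom⟦r⟧' =
        ShiftedHom.comp (l.inv ≫ u ≫ l.hom⟦q⟧') (l.inv ≫ v ≫ l.hom⟦p⟧') hr := by
    intro x y l u v
    have := (shiftFunctorAdd' A p q r hr).inv.naturality l.hom
    dsimp at this
    simp only [ShiftedHom.comp, Functor.map_comp, Category.assoc, ← this]
    rw [← Functor.map_comp_assoc _ l.hom l.inv, Iso.hom_inv_id]
    simp
  rw [centralHom_eq, centralHom_eq, centralHom_eq, ShiftedHom.map_comp]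
  exact key _ _ _

theorem centralHom_add (a : A) {p : ℤ} (h h' : ShiftedHom (𝟙_ C) (𝟙_ C) p) :
    centralHom a (h + h') = centralHom a h + centralHom a h' := by
  simp [centralHom, TriangulatedAction.add_left]

variable [∀ n : ℤ, (shiftFunctor C n).Additive]

/-- The homomorphism of graded rings `End^*_C(e) → End^*_A(a)`, `h ↦ centralHom a h`. -/
noncomputable def centralRingHom (a : A) : EndStar (𝟙_ C : C) →+* EndStar a :=
  DirectSum.toSemiring
    (fun p => (DirectSum.of (GHom a a) p).comp
      (AddMonoidHom.mk' (fun h : GHom (𝟙_ C) (𝟙_ C) p => (centralHom a h : GHom a a p))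
        (centralHom_add a)))
    (by
      exact congrArg (DirectSum.of (GHom a a) 0) (centralHom_one a))
    (by
      intro p q h h'
      refine (congrArg (DirectSum.of (GHom a a) (p + q)) (centralHom_comp a h' h rfl)).trans ?_
      exact (DirectSum.of_mul_of _ _).symm)

end CentralAction

/-! ### Homogeneous primes, localization and supports over graded-commutative rings -/

section Support

variable {H : Type*} [Ring H] (𝒜 : ℕ → AddSubgroup H)

/-- Graded-commutativity: `x y = (-1)^(m n) y x` for `x` of degree `m` and `y` of degree `n`. -/
class GradedCommutative : Prop where
  comm {m n : ℕ} {x y : H} (hx : x ∈ 𝒜 m) (hy : y ∈ 𝒜 n) : x * y = (-1) ^ (m * n) * (y * x)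

variable [GradedRing 𝒜]

/-- `Spec H`, the set of homogeneous prime ideals of `H`. (In a graded-commutative ring every
homogeneous left ideal is two-sided.) -/
structure HomogeneousSpec where
  /-- The underlying homogeneous ideal. -/
  ideal : HomogeneousIdeal 𝒜
  isPrime : ideal.toIdeal.IsPrime

variable {𝒜}

/-- The multiplicative set of homogeneous elements outside a homogeneous prime ideal. -/
def HomogeneousSpec.compl (P : HomogeneousSpec 𝒜) : Submonoid H where
  carrier := {x | SetLike.IsHomogeneousElem 𝒜 x ∧ x ∉ P.ideal.toIdeal}
  one_mem' := ⟨SetLike.isHomogeneousElem_one 𝒜,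
    fun h => P.isPrime.ne_top ((Ideal.eq_top_iff_one _).2 h)⟩
  mul_mem' := fun hx hy => ⟨hx.1.mul hy.1, fun h => (P.isPrime.mem_or_mem h).elim hx.2 hy.2⟩

/-- The square of a homogeneous element has even degree and is therefore central. -/
theorem GradedCommutative.sq_comm [GradedCommutative 𝒜] {s : H}
    (hs : SetLike.IsHomogeneousElem 𝒜 s) (r : H) : s * s * r = r * (s * s) := by
  obtain ⟨n, hn⟩ := hs
  have hss : s * s ∈ 𝒜 (n + n) := SetLike.GradedMul.mul_mem hn hn
  induction r using DirectSum.Decomposition.inductionOn 𝒜 with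
  | zero => simp
  | homogeneous m =>
    rename_i i
    rw [GradedCommutative.comm hss m.2, Even.neg_one_pow ((Even.add_self n).mul_right i), one_mul]
  | add a b ha hb => rw [mul_add, add_mul, ha, hb]

noncomputable instance [GradedCommutative 𝒜] (P : HomogeneousSpec 𝒜) :
    OreLocalization.OreSet P.compl where
  ore_right_cancel r₁ r₂ s h := by
    refine ⟨s * s, ?_⟩
    have h' : r₁ * ((s : H) * s) = r₂ * ((s : H) * s) := by rw [← mul_assoc, h, mul_assoc]
    rw [Submonoid.coe_mul, GradedCommutative.sq_comm (show SetLike.IsHomogeneousElem 𝒜 (s : H) from s.2.1), GradedCommutative.sq_comm (show SetLike.IsHomogeneousElem 𝒜 (s : H) from s.2.1), h']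
  oreNum r s := r * s
  oreDenom _ s := s * s
  ore_eq r s := by
    rw [Submonoid.coe_mul, GradedCommutative.sq_comm (show SetLike.IsHomogeneousElem 𝒜 (s : H) from s.2.1), mul_assoc]

variable (𝒜) in
/-- The support of a left `H`-module: all `P` in `Spec H` with nonzero (homogeneous)
localization `M_P`. -/
def supp [GradedCommutative 𝒜] (M : Type*) [AddCommGroup M] [Module H M] :
    Set (HomogeneousSpec 𝒜) :=
  {P | Nontrivial (OreLocalization P.compl M)}

/-- The closed homogeneous subvariety `V(I) = Supp (H / I)` of a homogeneous ideal `I`. -/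
def zeroLocus [GradedCommutative 𝒜] (I : HomogeneousIdeal 𝒜) : Set (HomogeneousSpec 𝒜) :=
  supp 𝒜 (H ⧸ I.toIdeal)

end Support

/-! ### Support varieties -/

section SupportVariety

variable {C A : Type*} [Category* C] [Preadditive C] [HasShift C ℤ] [MonoidalCategory C]
  [∀ n : ℤ, (shiftFunctor C n).Additive]
  [Category* A] [Preadditive A] [HasZeroObject A] [HasShift A ℤ]
  [∀ n : ℤ, (shiftFunctor A n).Additive] [Pretriangulated A] [IsTriangulated A]
  [MonoidalLeftAction C A] [TriangulatedAction C A]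
  {H : Type*} [Ring H]

/-- The left `H`-module structure of `Hom^*_A(a, b)` induced by `H → End^*_C(e) → End^*_A(b)`. -/
noncomputable abbrev homStarModule (θ : H →+* EndStar (𝟙_ C : C)) (a b : A) :
    Module H (HomStar a b) :=
  Module.compHom (HomStar a b) ((centralRingHom b).comp θ)

/-- The support variety `V(a, b) = Supp (Hom^*_A(a, b))`. -/
def supportVarietyPair (𝒜 : ℕ → AddSubgroup H) [GradedRing 𝒜] [GradedCommutative 𝒜]
    (θ : H →+* EndStar (𝟙_ C : C)) (a b : A) : Set (HomogeneousSpec 𝒜) :=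
  letI := homStarModule θ a b
  supp 𝒜 (HomStar a b)

/-- The support variety `V(a) = V(a, a)`. -/
def supportVariety (𝒜 : ℕ → AddSubgroup H) [GradedRing 𝒜] [GradedCommutative 𝒜]
    (θ : H →+* EndStar (𝟙_ C : C)) (a : A) : Set (HomogeneousSpec 𝒜) :=
  supportVarietyPair 𝒜 θ a a

end SupportVariety

/-! The closed sets are realized by Koszul objects. Write `φ_a : H → End^*(a)` for the composite
ring map. Since `End^*(a)` contains `1`, a homogeneous prime `P` lies in `V(a)` iff `ker φ_a ⊆ P`
(`mem_supportVariety_iff`). It therefore suffices to find, for `h` homogeneous, an object `c` with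
`V(c) = V(a) ∩ V(h)`, and to iterate over finitely many homogeneous generators of `I`.

Take `c` to be a cone of the action of `h²` on `a`. The action of `H` is natural and commutes with
suspension up to sign (`centralHom_naturality`, `centralHom_shift`), so long exact sequence
arguments apply. A class killing `a`, and `h²` itself, act on `c` with square zero
(`centralHom_comp_self_eq_zero`), which gives `V(c) ⊆ V(a) ∩ V(h)`. Conversely, a class `s` killing
`c` acts on `a` as `h² w` for some `w` in `End^*(a)` (`exists_comp_centralHom_eq`). As `End^*(a)` is
Noetherian over `H`, a Nakayama argument (`exists_pow_sub_mul_mem_ker`) puts some `s^k - j h²` in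
`ker φ_a`, so a prime containing `ker φ_a` and `h` contains `s`. -/

/-! ### The suspension isomorphisms of an action -/

section Action

variable {C A : Type*} [Category* C] [Preadditive C] [HasShift C ℤ] [MonoidalCategory C]
  [Category* A] [Preadditive A] [HasZeroObject A] [HasShift A ℤ]
  [∀ n : ℤ, (shiftFunctor A n).Additive] [Pretriangulated A] [IsTriangulated A]
  [MonoidalLeftAction C A] [TriangulatedAction C A]

/-- The isomorphism `T^p x ⊙ₗ a ≅ Σ^p (x ⊙ₗ a)`. -/
noncomputable def actRho (x : C) (a : A) (p : ℤ) : (x⟦p⟧) ⊙ₗ a ⟶ (x ⊙ₗ a)⟦p⟧ :=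
  (((MonoidalLeftAction.curriedAction C A).flip.obj a).commShiftIso p).hom.app x

/-- The isomorphism `x ⊙ₗ Σ a ≅ Σ (x ⊙ₗ a)`. -/
noncomputable def actLam (x : C) (a : A) : x ⊙ₗ (a⟦(1 : ℤ)⟧) ⟶ (x ⊙ₗ a)⟦(1 : ℤ)⟧ :=
  (((MonoidalLeftAction.curriedAction C A).obj x).commShiftIso (1 : ℤ)).hom.app a

theorem actRho_naturality_right (x : C) {a b : A} (g : a ⟶ b) (p : ℤ) :
    (x⟦p⟧) ⊴ₗ g ≫ actRho x b p = actRho x a p ≫ (x ⊴ₗ g)⟦p⟧' :=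
  (NatTrans.shift_app_comm ((MonoidalLeftAction.curriedAction C A).flip.map g) p x).symm

theorem actLam_naturality_left {x y : C} (f : x ⟶ y) (a : A) :
    f ⊵ₗ (a⟦(1 : ℤ)⟧) ≫ actLam y a = actLam x a ≫ (f ⊵ₗ a)⟦(1 : ℤ)⟧' :=
  (NatTrans.shift_app_comm ((MonoidalLeftAction.curriedAction C A).map f) (1 : ℤ) a).symm

theorem actRho_zero (x : C) (a : A) :
    actRho x a 0 = ((shiftFunctorZero C ℤ).hom.app x) ⊵ₗ a ≫
      (shiftFunctorZero A ℤ).inv.app (x ⊙ₗ a) := by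
  rw [actRho, Functor.commShiftIso_zero, Functor.CommShift.isoZero_hom_app]
  rfl

theorem actRho_add (x : C) (a : A) (p q : ℤ) :
    actRho x a (p + q) = ((shiftFunctorAdd C p q).hom.app x) ⊵ₗ a ≫ actRho (x⟦p⟧) a q ≫
      (actRho x a p)⟦q⟧' ≫ (shiftFunctorAdd A p q).inv.app (x ⊙ₗ a) := by
  rw [actRho, Functor.commShiftIso_add, Functor.CommShift.isoAdd_hom_app]
  rfl

theorem actLam_actRho_one (x : C) (a : A) :
    actLam (x⟦(1 : ℤ)⟧) a ≫ (actRho x a 1)⟦(1 : ℤ)⟧' =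
      -(actRho x (a⟦(1 : ℤ)⟧) 1 ≫ (actLam x a)⟦(1 : ℤ)⟧') :=
  SuspensionBifunctor.anticomm (G := MonoidalLeftAction.curriedAction C A) x a

theorem actLam_unit (a : A) :
    actLam (𝟙_ C) a ≫ ((λₗ[C] a).hom)⟦(1 : ℤ)⟧' = (λₗ[C] (a⟦(1 : ℤ)⟧)).hom :=
  TriangulatedAction.lam_unit a

/-- The two isomorphisms `T^p x ⊙ₗ Σ a ≅ Σ^(p+1) (x ⊙ₗ a)` agree up to sign. -/
theorem actLam_actRho (p : ℤ) (hp : 0 ≤ p) : ∃ ε : ℤˣ, ∀ (x : C) (a : A),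
    actLam (x⟦p⟧) a ≫ (actRho x a p)⟦(1 : ℤ)⟧' =
      ε • (actRho x (a⟦(1 : ℤ)⟧) p ≫ (actLam x a)⟦p⟧' ≫ (shiftComm (x ⊙ₗ a) (1 : ℤ) p).hom) := by
  induction p, hp using Int.leInduction with
  | base =>
    refine ⟨1, fun x a => ?_⟩
    have h1 := (shiftFunctorZero A ℤ).inv.naturality (actLam x a)
    have h2 := actLam_naturality_left ((shiftFunctorZero C ℤ).hom.app x) a
    dsimp at h1 h2
    simp only [actRho_zero, one_smul, Functor.map_comp, Category.assoc]
    rw [← reassoc_of% h2, ← reassoc_of% h1]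
    congr 2
    simp [shiftFunctorComm_zero_hom_app]
  | succ p hp ih =>
    obtain ⟨ε, hε⟩ := ih
    -- Peeling off one suspension uses the anticommuting square once and so costs one sign; the
    -- total sign is `(-1)^p`, independent of `x` and `a`. What remains is coherence of the shifts.
    refine ⟨-ε, fun x a => ?_⟩
    have h1 := actLam_naturality_left ((shiftFunctorAdd C p 1).hom.app x) a
    have h2 := actLam_actRho_one (x⟦p⟧) a
    have h3 := (shiftFunctorAdd A p 1).inv.naturality (actLam x a)
    have h4 := congrArg (fun t => t⟦(1 : ℤ)⟧') (hε x a)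
    have h5 := shiftFunctorComm_hom_app_comp_shift_shiftFunctorAdd_hom_app (1 : ℤ) p 1 (x ⊙ₗ a)
    have h6 : (shiftFunctorAdd A p 1).inv.app ((x ⊙ₗ a)⟦(1 : ℤ)⟧) ≫
        (shiftFunctorComm A (1 : ℤ) (p + 1)).hom.app (x ⊙ₗ a) =
        ((shiftFunctorComm A (1 : ℤ) p).hom.app (x ⊙ₗ a))⟦(1 : ℤ)⟧' ≫
          ((shiftFunctorAdd A p 1).inv.app (x ⊙ₗ a))⟦(1 : ℤ)⟧' := by
      rw [← cancel_mono (((shiftFunctorAdd A p 1).hom.app (x ⊙ₗ a))⟦(1 : ℤ)⟧'),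
        Category.assoc, h5, Category.assoc, ← Functor.map_comp, Iso.inv_hom_id_app]
      simp
    dsimp at h1 h2 h3 h4 h6
    simp only [Functor.map_comp, Functor.map_units_smul] at h4
    simp only [actRho_add, Functor.map_comp, Category.assoc]
    rw [← reassoc_of% h1, reassoc_of% h2, ← reassoc_of% h3]
    dsimp
    rw [h6]
    simp only [Category.assoc, Preadditive.neg_comp, Preadditive.comp_neg, Units.neg_smul]
    congr 1
    rw [reassoc_of% h4]
    simp [Linear.units_smul_comp, Linear.comp_units_smul]

theorem centralHom_def (a : A) {p : ℤ} (h : ShiftedHom (𝟙_ C) (𝟙_ C) p) :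
    centralHom a h = (λₗ[C] a).inv ≫ h ⊵ₗ a ≫ actRho (𝟙_ C) a p ≫ ((λₗ[C] a).hom)⟦p⟧' :=
  rfl

/-- The class acts through the first variable of the bifunctor and `f` through the second, so they
interchange; naturality of `rho` in the second variable does the rest. -/
theorem centralHom_naturality {a b : A} (f : a ⟶ b) {p : ℤ} (h : ShiftedHom (𝟙_ C) (𝟙_ C) p) :
    f ≫ centralHom b h = centralHom a h ≫ f⟦p⟧' := by
  have h1 := actRho_naturality_right (𝟙_ C) f p
  have h2 := MonoidalLeftAction.action_exchange h f
  simp only [centralHom_def, Category.assoc, ← Functor.map_comp]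
  rw [MonoidalLeftAction.actionUnitIso_hom_naturality, Functor.map_comp, ← reassoc_of% h1,
    ← reassoc_of% h2]
  simp

/-- The compatibility of `lam` with the unit identifies `e ⊙ₗ Σ a` with `Σ (e ⊙ₗ a)`; moving `lam`
past `rho_p` yields the sign. Its value never matters: only vanishing and factorization are used
later. -/
theorem centralHom_shift_one (p : ℤ) (hp : 0 ≤ p) : ∃ ε : ℤˣ, ∀ (a : A)
    (h : ShiftedHom (𝟙_ C) (𝟙_ C) p),
    centralHom (a⟦(1 : ℤ)⟧) h = ε • ((centralHom a h)⟦(1 : ℤ)⟧' ≫ (shiftComm a p (1 : ℤ)).hom) := by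
  obtain ⟨ε, hε⟩ := actLam_actRho (C := C) (A := A) p hp
  refine ⟨ε, fun a h => ?_⟩
  have h1 := actLam_unit (C := C) a
  have h2 := actLam_naturality_left h a
  have h3 := hε (𝟙_ C) a
  have h4 := (shiftFunctorComm A p (1 : ℤ)).hom.naturality (λₗ[C] a).hom
  have h5 : (λₗ[C] (a⟦(1 : ℤ)⟧)).inv ≫ actLam (𝟙_ C) a = ((λₗ[C] a).inv)⟦(1 : ℤ)⟧' := by
    rw [Iso.inv_comp_eq, ← h1, Category.assoc, ← Functor.map_comp, Iso.hom_inv_id]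
    simp
  have h6 : (shiftFunctorComm A (1 : ℤ) p).hom.app (𝟙_ C ⊙ₗ a) ≫
      (shiftFunctorComm A p (1 : ℤ)).hom.app (𝟙_ C ⊙ₗ a) = 𝟙 _ := by
    rw [← shiftFunctorComm_symm A p 1]
    simp
  dsimp at h2 h3 h4
  simp only [centralHom_def, Functor.map_comp, Category.assoc, Iso.app_hom]
  rw [h4, ← h5, Category.assoc, ← reassoc_of% h2, reassoc_of% h3, ← h1]
  simp only [Linear.units_smul_comp, Linear.comp_units_smul, smul_smul, Int.units_mul_self,
    one_smul, Category.assoc, reassoc_of% h6, Functor.map_comp]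

theorem centralHom_shift (p n : ℤ) (hp : 0 ≤ p) (hn : 0 ≤ n) : ∃ ε : ℤˣ, ∀ (a : A)
    (h : ShiftedHom (𝟙_ C) (𝟙_ C) p),
    centralHom (a⟦n⟧) h = ε • ((centralHom a h)⟦n⟧' ≫ (shiftComm a p n).hom) := by
  induction n, hn using Int.leInduction with
  | base =>
    refine ⟨1, fun a h => ?_⟩
    have h1 := centralHom_naturality ((shiftFunctorZero A ℤ).hom.app a) h
    have h2 := (shiftFunctorZero A ℤ).hom.naturality (centralHom a h)
    dsimp at h1 h2
    rw [← cancel_mono (((shiftFunctorZero A ℤ).hom.app a)⟦p⟧'), ← h1, one_smul, Category.assoc]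
    simp only [Iso.app_hom, shiftFunctorComm_zero_hom_app, Category.assoc, ← Functor.map_comp,
      Iso.inv_hom_id_app]
    simp [h2]
  | succ n hn ih =>
    obtain ⟨ε, hε⟩ := ih
    obtain ⟨ε', hε'⟩ := centralHom_shift_one (C := C) (A := A) p hp
    refine ⟨ε' * ε, fun a h => ?_⟩
    have h1 := centralHom_naturality ((shiftFunctorAdd A n 1).hom.app a) h
    have h2 := (shiftFunctorAdd A n 1).hom.naturality (centralHom a h)
    have h3 := shiftFunctorComm_hom_app_comp_shift_shiftFunctorAdd_hom_app p n 1 a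
    dsimp at h1 h2
    rw [← cancel_mono (((shiftFunctorAdd A n 1).hom.app a)⟦p⟧'), ← h1, hε', hε]
    simp only [Linear.units_smul_comp, Linear.comp_units_smul, Functor.map_units_smul, smul_smul,
      Category.assoc, Iso.app_hom, h3, Functor.map_comp, reassoc_of% h2]

end Action

/-! ### Action of homogeneous classes on cones -/

section Cone

variable {C A : Type*} [Category* C] [Preadditive C] [HasShift C ℤ] [MonoidalCategory C]
  [Category* A] [Preadditive A] [HasZeroObject A] [HasShift A ℤ]
  [∀ n : ℤ, (shiftFunctor A n).Additive] [Pretriangulated A] [IsTriangulated A]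
  [MonoidalLeftAction C A] [TriangulatedAction C A]

open Pretriangulated

/-- By naturality `h₂` says that `s` on `z` vanishes after `i`, hence factors as `d ≫ g`. By
naturality and `h₁`, `s` on `z` followed by `d⟦p⟧'` is zero. Substituting the factorization into the
second factor of the square kills it. -/
theorem centralHom_comp_self_eq_zero {x y z : A} {f : x ⟶ y} {i : y ⟶ z} {d : z ⟶ x⟦(1 : ℤ)⟧}
    (hT : Triangle.mk f i d ∈ distTriang A) {p : ℤ} (s : ShiftedHom (𝟙_ C) (𝟙_ C) p)
    (h₂ : centralHom y s ≫ i⟦p⟧' = 0) (h₁ : d ≫ centralHom (x⟦(1 : ℤ)⟧) s = 0) :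
    (centralHom z s).comp (centralHom z s) rfl = 0 := by
  obtain ⟨g, hg⟩ : ∃ g : x⟦(1 : ℤ)⟧ ⟶ z⟦p⟧, centralHom z s = d ≫ g :=
    Triangle.yoneda_exact₃ _ hT (centralHom z s) ((centralHom_naturality i s).trans h₂)
  have h : centralHom z s ≫ d⟦p⟧' = 0 := by rw [← centralHom_naturality, h₁]
  rw [ShiftedHom.comp]
  conv_lhs => rw [hg, Functor.map_comp, ← hg]
  rw [Category.assoc, reassoc_of% h, zero_comp]

theorem centralHom_shift_eq_zero {a : A} {p n : ℤ} (hp : 0 ≤ p) (hn : 0 ≤ n)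
    {s : ShiftedHom (𝟙_ C) (𝟙_ C) p} (hs : centralHom a s = 0) : centralHom (a⟦n⟧) s = 0 := by
  obtain ⟨ε, hε⟩ := centralHom_shift (C := C) (A := A) p n hp hn
  rw [hε, hs, Functor.map_zero, zero_comp, smul_zero]

/-- A class annihilating `a` also annihilates every cone of an operator `a ⟶ Σ^n a`, up to
nilpotence. -/
theorem centralHom_cone_of_eq_zero {a c : A} {n : ℤ} (hn : 0 ≤ n) {f : a ⟶ a⟦n⟧} {i : a⟦n⟧ ⟶ c}
    {d : c ⟶ a⟦(1 : ℤ)⟧} (hT : Triangle.mk f i d ∈ distTriang A) {p : ℤ} (hp : 0 ≤ p)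
    {s : ShiftedHom (𝟙_ C) (𝟙_ C) p} (hs : centralHom a s = 0) :
    (centralHom c s).comp (centralHom c s) rfl = 0 := by
  refine centralHom_comp_self_eq_zero hT s ?_ ?_
  · rw [centralHom_shift_eq_zero hp hn hs, zero_comp]
  · rw [centralHom_shift_eq_zero hp zero_le_one hs, comp_zero]

/-- A class `h` acts nilpotently on the cone of its action on `a`. -/
theorem centralHom_cone_self {a c : A} {n : ℤ} (hn : 0 ≤ n) (h : ShiftedHom (𝟙_ C) (𝟙_ C) n)
    {i : a⟦n⟧ ⟶ c} {d : c ⟶ a⟦(1 : ℤ)⟧}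
    (hT : Triangle.mk (centralHom a h) i d ∈ distTriang A) :
    (centralHom c h).comp (centralHom c h) rfl = 0 := by
  obtain ⟨ε, hε⟩ := centralHom_shift (C := C) (A := A) n n hn hn
  obtain ⟨ε', hε'⟩ := centralHom_shift_one (C := C) (A := A) n hn
  have h12 : centralHom a h ≫ i = 0 := comp_distTriang_mor_zero₁₂ _ hT
  have h31 : d ≫ (centralHom a h)⟦(1 : ℤ)⟧' = 0 := comp_distTriang_mor_zero₃₁ _ hT
  refine centralHom_comp_self_eq_zero hT h ?_ ?_
  -- Class and shift have the same degree `n`, so the interchange of shifts is the identity and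
  -- `centralHom a h ≫ i = 0` applies after shifting.
  · rw [hε, Iso.app_hom, shiftFunctorComm_eq_refl]
    simp [← Functor.map_comp, h12]
  · rw [hε', Linear.comp_units_smul, reassoc_of% h31, zero_comp, smul_zero]

/-- A class annihilating the cone of the action of `h` on `a` acts on `a` as a multiple of `h`. -/
theorem exists_comp_centralHom_eq {a c : A} {n : ℤ} (hn : 0 ≤ n)
    (h : ShiftedHom (𝟙_ C) (𝟙_ C) n) {i : a⟦n⟧ ⟶ c} {d : c ⟶ a⟦(1 : ℤ)⟧}
    (hT : Triangle.mk (centralHom a h) i d ∈ distTriang A) {p m : ℤ} (hp : 0 ≤ p)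
    (hm : n + m = p) {s : ShiftedHom (𝟙_ C) (𝟙_ C) p} (hs : centralHom c s = 0) :
    ∃ w : ShiftedHom a a m, w.comp (centralHom a h) hm = centralHom a s := by
  obtain ⟨ε, hε⟩ := centralHom_shift (C := C) (A := A) p n hp hn
  have h0 : centralHom (a⟦n⟧) s ≫ i⟦p⟧' = 0 := by rw [← centralHom_naturality, hs, comp_zero]
  have hm' : m + n = p := by rw [add_comm, hm]
  obtain ⟨u, hu⟩ : ∃ u : a⟦n⟧ ⟶ a⟦p⟧, (centralHom a s)⟦n⟧' ≫ (shiftComm a p n).hom =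
      u ≫ (centralHom a h)⟦p⟧' := by
    -- The maps of the `p`-fold shift of a distinguished triangle carry the sign `(-1)^p`; exactness
    -- at its second vertex lifts `s` on `a⟦n⟧` through `h`.
    have h1 : centralHom (a⟦n⟧) s ≫ (p.negOnePow • i⟦p⟧') = 0 := by
      rw [Linear.comp_units_smul, h0, smul_zero]
    obtain ⟨u, hu⟩ : ∃ u : a⟦n⟧ ⟶ a⟦p⟧, centralHom (a⟦n⟧) s =
        u ≫ (p.negOnePow • (centralHom a h)⟦p⟧') :=
      Triangle.coyoneda_exact₂ _ (Triangle.shift_distinguished _ hT p) _ h1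
    refine ⟨ε • p.negOnePow • u, ?_⟩
    rw [hε, Linear.comp_units_smul] at hu
    rw [Linear.units_smul_comp, Linear.units_smul_comp, ← hu, smul_smul, Int.units_mul_self,
      one_smul]
  -- The factor lives on `a⟦n⟧`; since the shift is fully faithful, it descends to an operator on
  -- `a` of degree `m = p - n`, possibly negative.
  obtain ⟨w, hw⟩ := (shiftFunctor A n).map_surjective
    (u ≫ (shiftFunctorAdd' A m n p hm').hom.app a)
  refine ⟨w, (shiftFunctor A n).map_injective ?_⟩
  have h1 := (shiftFunctorAdd' A m n p hm').hom.naturality (centralHom a h)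
  have h2 := shiftFunctorAdd'_assoc_hom_app n m n p p (p + n) hm hm' (by rw [hm]) a
  have h3 : (shiftComm a p n).hom = ((shiftFunctorAdd' A n m p hm).hom.app a)⟦n⟧' ≫
      (shiftFunctorAdd' A m n p hm').inv.app (a⟦n⟧) := by
    rw [Iso.app_hom, shiftFunctorComm_eq A p n (p + n) rfl, ← cancel_mono
      ((shiftFunctorAdd' A m n p hm').hom.app (a⟦n⟧)), ← cancel_epi
      ((shiftFunctorAdd' A p n (p + n) rfl).hom.app a)]
    simp [h2]
  dsimp at h1
  rw [ShiftedHom.comp, Functor.map_comp, hw, Functor.map_comp, Category.assoc, ← reassoc_of% h1,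
    ← reassoc_of% hu, h3]
  simp [← Functor.map_comp]

end Cone

/-! ### Supports -/

section SupportLemmas

variable {H : Type*} [Ring H] {𝒜 : ℕ → AddSubgroup H} [GradedRing 𝒜]

theorem mem_homogeneousIdeal_of_decompose_mem (I : HomogeneousIdeal 𝒜) {t : H}
    (h : ∀ n, (DirectSum.decompose 𝒜 t n : H) ∈ I.toIdeal) : t ∈ I.toIdeal := by
  classical
  rw [← DirectSum.sum_support_decompose 𝒜 t]
  exact sum_mem fun n _ => h n

variable [GradedCommutative 𝒜]

theorem mem_supp_iff {M : Type*} [AddCommGroup M] [Module H M] (P : HomogeneousSpec 𝒜) :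
    P ∈ supp 𝒜 M ↔ ∃ m : M, ∀ s ∈ P.compl, s • m ≠ 0 := by
  constructor
  · intro (hP : Nontrivial _)
    by_contra! hall
    refine not_subsingleton (OreLocalization P.compl M) ⟨fun x y => ?_⟩
    have h0 : ∀ z : OreLocalization P.compl M, z = 0 := by
      intro z
      induction z using OreLocalization.ind with
      | _ m t =>
        obtain ⟨s, hs, h⟩ := hall m
        rw [OreLocalization.expand' m t ⟨s, hs⟩, Submonoid.smul_def, h, OreLocalization.zero_oreDiv]
    rw [h0 x, h0 y]
  · rintro ⟨m, hm⟩
    refine ⟨OreLocalization.oreDiv m 1, 0, fun h => ?_⟩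
    rw [OreLocalization.zero_def, OreLocalization.oreDiv_eq_iff] at h
    -- Equality of `m / 1` with zero in the Ore localization forces `u = v`, so `u` is a homogeneous
    -- element outside `P` killing `m`.
    obtain ⟨u, v, h1, h2⟩ := h
    simp only [OneMemClass.coe_one, mul_one] at h2
    rw [smul_zero, ← h2] at h1
    exact hm u u.2 h1.symm

theorem mem_zeroLocus_iff (I : HomogeneousIdeal 𝒜) (P : HomogeneousSpec 𝒜) :
    P ∈ zeroLocus I ↔ I.toIdeal ≤ P.ideal.toIdeal := by
  refine (mem_supp_iff P).trans ⟨?_, fun hP => ⟨Submodule.Quotient.mk 1, fun s hs h => ?_⟩⟩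
  · rintro ⟨m, hm⟩ t ht
    refine mem_homogeneousIdeal_of_decompose_mem _ fun n => ?_
    by_contra hn
    obtain ⟨r, rfl⟩ := Submodule.Quotient.mk_surjective _ m
    have hs : (DirectSum.decompose 𝒜 t n : H) ∈ P.compl := ⟨⟨n, SetLike.coe_mem _⟩, hn⟩
    -- Here `I` is a left ideal, so a component `s` in `I` need not visibly kill the class of `r`;
    -- its central square does, as `s s r = r s s`.
    refine hm _ (mul_mem hs hs) ?_
    rw [← Submodule.Quotient.mk_smul, Submodule.Quotient.mk_eq_zero, smul_eq_mul,
      GradedCommutative.sq_comm hs.1]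
    exact Ideal.mul_mem_left _ _ (Ideal.mul_mem_left _ _ (I.isHomogeneous n ht))
  · rw [← Submodule.Quotient.mk_smul, Submodule.Quotient.mk_eq_zero, smul_eq_mul, mul_one] at h
    exact hs.2 (hP h)

end SupportLemmas

/-! ### A Nakayama argument for noncommutative operators -/

section Ring

/-- Nakayama-type statement: if the operator `s` is a right multiple of the operator `h` on a
Noetherian module, then some power of `s` is congruent modulo `h` to an operator equal to zero. -/
theorem exists_pow_sub_mul_mem_ker {H R : Type*} [Ring H] [Ring R] (φ : H →+* R)
    (hR : letI := Module.compHom R φ; IsNoetherian H R) {h s : H} (hh : ∀ x, h * x = x * h)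
    {w : R} (hw : φ s = φ h * w) : ∃ (k : ℕ) (j : H), s ^ k - j * h ∈ RingHom.ker φ := by
  let := Module.compHom R φ
  have hsmul : ∀ (x : H) (y : R), x • y = φ x * y := fun _ _ => rfl
  -- `w` need not commute with `φ h`; it is enough that `φ h` commutes with the image of `H`, in
  -- particular with `φ s`.
  have hpow : ∀ i : ℕ, φ h ^ i * w ^ i = φ s ^ i := by
    intro i
    induction i with
    | zero => simp
    | succ i ih =>
      have hc : Commute (φ h ^ i) (φ s) := by
        rw [← map_pow]
        exact ((Commute.pow_left (hh s) i : Commute (h ^ i) s)).map φ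
      rw [pow_succ (φ h), mul_assoc, pow_succ' w, ← mul_assoc (φ h) w, ← hw, ← mul_assoc, hc.eq,
        mul_assoc, ih, pow_succ']
  let W : ℕ →o Submodule H R :=
    ⟨fun k => Submodule.span H ((fun i => w ^ i) '' Set.Iio k),
      fun k l hkl => Submodule.span_mono (Set.image_mono (Set.Iio_subset_Iio hkl))⟩
  obtain ⟨k, hk⟩ := monotone_stabilizes_iff_noetherian.2 hR W
  have hmem : w ^ k ∈ W k := by
    rw [hk (k + 1) k.le_succ]
    exact Submodule.subset_span ⟨k, Nat.lt_succ_self k, rfl⟩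
  -- For `i < k` one has `φ(h)^k w^i = φ(h^(k-i) s^i)`, with at least one factor `h` left. Applied
  -- to `w ^ k` in `W k`, this rewrites `φ(s)^k = φ(h)^k w^k` as a multiple of `φ h`.
  have hall : ∀ y ∈ W k, ∃ j : H, φ h ^ k * y = φ (j * h) := by
    intro y hy
    induction hy using Submodule.span_induction with
    | mem y hy =>
      obtain ⟨i, hi, rfl⟩ := hy
      obtain ⟨l, rfl⟩ := Nat.exists_eq_add_of_lt (show i < k from hi)
      refine ⟨h ^ l * s ^ i, ?_⟩
      dsimp only
      rw [show i + l + 1 = (l + 1) + i by ring, pow_add, mul_assoc, hpow, mul_assoc, ← hh, ← mul_assoc,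
        ← pow_succ]
      simp
    | zero => exact ⟨0, by simp⟩
    | add x y _ _ hx hy =>
      obtain ⟨i, hi⟩ := hx
      obtain ⟨j, hj⟩ := hy
      exact ⟨i + j, by rw [mul_add, hi, hj, ← map_add, add_mul]⟩
    | smul r y _ hy =>
      obtain ⟨j, hj⟩ := hy
      have hc : Commute (φ h ^ k) (φ r) := by
        rw [← map_pow]
        exact ((Commute.pow_left (hh r) k : Commute (h ^ k) r)).map φ
      exact ⟨r * j, by rw [hsmul, ← mul_assoc, hc.eq, mul_assoc, hj, ← map_mul, mul_assoc]⟩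
  obtain ⟨j, hj⟩ := hall _ hmem
  exact ⟨k, j, by rw [RingHom.mem_ker, map_sub, map_pow, ← hpow, hj, sub_self]⟩

end Ring

/-! ### Support varieties as closed sets of annihilators -/

section SupportVarietyLemmas

theorem endStar_smul_eq_mul {D : Type*} [Category* D] [HasShift D ℤ] [Preadditive D]
    [∀ n : ℤ, (shiftFunctor D n).Additive] (a : D) (r m : EndStar a) : r • m = r * m := by
  induction r using DirectSum.induction_on with
  | zero => rw [zero_smul, zero_mul]
  | add x y hx hy => rw [add_smul, add_mul, hx, hy]
  | of p x =>
    induction m using DirectSum.induction_on with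
    | zero => rw [smul_zero, mul_zero]
    | add y z hy hz => rw [smul_add, mul_add, hy, hz]
    | of q y => exact (DirectSum.Gmodule.of_smul_of _ _ x y).trans (DirectSum.of_mul_of x y).symm

variable {C A : Type*} [Category* C] [Preadditive C] [HasShift C ℤ] [MonoidalCategory C]
  [∀ n : ℤ, (shiftFunctor C n).Additive]
  [Category* A] [Preadditive A] [HasZeroObject A] [HasShift A ℤ]
  [∀ n : ℤ, (shiftFunctor A n).Additive] [Pretriangulated A] [IsTriangulated A]
  [MonoidalLeftAction C A] [TriangulatedAction C A]
  {H : Type*} [Ring H] {𝒜 : ℕ → AddSubgroup H} [GradedRing 𝒜]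

theorem centralRingHom_of (a : A) {p : ℤ} (h : GHom (𝟙_ C) (𝟙_ C) p) :
    centralRingHom a (DirectSum.of (GHom (𝟙_ C) (𝟙_ C)) p h) =
      DirectSum.of (GHom a a) p (centralHom a h) :=
  DirectSum.toSemiring_of _ _ _ _ _

theorem homStarModule_smul_def (θ : H →+* EndStar (𝟙_ C : C)) (a : A) (x : H) (m : EndStar a) :
    letI := homStarModule θ a a
    x • m = ((centralRingHom a).comp θ) x * m :=
  endStar_smul_eq_mul a _ m

/-- Gradedness of the composite map makes its kernel homogeneous, so elements of the kernel can be
treated one degree at a time. -/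
theorem centralRingHom_comp_apply_component {θ : H →+* EndStar (𝟙_ C : C)}
    (hθ : ∀ (n : ℕ), ∀ x ∈ 𝒜 n,
      ∃ h : GHom (𝟙_ C) (𝟙_ C) (n : ℤ), θ x = DirectSum.of (GHom (𝟙_ C) (𝟙_ C)) (n : ℤ) h)
    (a : A) (t : H) (n : ℕ) :
    (centralRingHom a).comp θ (DirectSum.decompose 𝒜 t n) =
      DirectSum.of (GHom a a) (n : ℤ) (((centralRingHom a).comp θ t) (n : ℤ)) := by
  induction t using DirectSum.Decomposition.inductionOn 𝒜 with
  | zero => simp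
  | add x y hx hy =>
    rw [DirectSum.decompose_add, DirectSum.add_apply, AddSubgroup.coe_add, map_add, hx, hy, map_add,
      DirectSum.add_apply, map_add]
  | homogeneous x =>
    rename_i i
    obtain ⟨h, hh⟩ := hθ i x x.2
    obtain ⟨y, hx⟩ : ∃ y : GHom a a (i : ℤ),
        (centralRingHom a).comp θ x = DirectSum.of (GHom a a) (i : ℤ) y :=
      ⟨centralHom a h, by rw [RingHom.comp_apply, hh, centralRingHom_of]⟩
    by_cases hin : i = n
    · subst hin
      rw [DirectSum.decompose_of_mem_same _ x.2, hx, DirectSum.of_eq_same]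
    · rw [DirectSum.decompose_of_mem_ne _ x.2 hin, hx, DirectSum.of_eq_of_ne]
      · rw [map_zero, map_zero]
      · exact fun h => hin (by exact_mod_cast h.symm)

variable [GradedCommutative 𝒜]

/-- `H` acts by left multiplication through a ring map, so its annihilator is the kernel, already
detected on the single element `1`. This takes the place of the finite generation usually needed for
"support equals closed set of the annihilator". -/
theorem mem_supportVariety_iff {θ : H →+* EndStar (𝟙_ C : C)}
    (hθ : ∀ (n : ℕ), ∀ x ∈ 𝒜 n,
      ∃ h : GHom (𝟙_ C) (𝟙_ C) (n : ℤ), θ x = DirectSum.of (GHom (𝟙_ C) (𝟙_ C)) (n : ℤ) h)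
    (a : A) (P : HomogeneousSpec 𝒜) :
    P ∈ supportVariety 𝒜 θ a ↔
      RingHom.ker ((centralRingHom a).comp θ) ≤ P.ideal.toIdeal := by
  let := homStarModule θ a a
  refine (mem_supp_iff (M := HomStar a a) P).trans ⟨?_, fun hP => ⟨(1 : EndStar a), ?_⟩⟩
  · rintro ⟨m, hm⟩ t ht
    refine mem_homogeneousIdeal_of_decompose_mem _ fun n => ?_
    by_contra hn
    refine hm _ ⟨⟨n, SetLike.coe_mem _⟩, hn⟩ ?_
    rw [homStarModule_smul_def, centralRingHom_comp_apply_component hθ, (RingHom.mem_ker).1 ht]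
    simp
  · rintro s hs h
    rw [homStarModule_smul_def, mul_one] at h
    exact hs.2 (hP h)

end SupportVarietyLemmas

/-! ### Koszul objects and realization -/

section Realization

variable {C A : Type*} [Category* C] [Preadditive C] [HasShift C ℤ] [MonoidalCategory C]
  [∀ n : ℤ, (shiftFunctor C n).Additive]
  [Category* A] [Preadditive A] [HasZeroObject A] [HasShift A ℤ]
  [∀ n : ℤ, (shiftFunctor A n).Additive] [Pretriangulated A] [IsTriangulated A]
  [MonoidalLeftAction C A] [TriangulatedAction C A]
  {H : Type*} [Ring H] {𝒜 : ℕ → AddSubgroup H} [GradedRing 𝒜] [GradedCommutative 𝒜]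

/-- Passing to a Koszul object: the cone of the action of `h²` on `a` has support variety
`V(a) ∩ V(h)`. -/
theorem exists_supportVariety_eq_inter [IsNoetherianRing H] {θ : H →+* EndStar (𝟙_ C : C)}
    (hθ : ∀ (n : ℕ), ∀ x ∈ 𝒜 n,
      ∃ h : GHom (𝟙_ C) (𝟙_ C) (n : ℤ), θ x = DirectSum.of (GHom (𝟙_ C) (𝟙_ C)) (n : ℤ) h)
    (a : A) (hfin : letI := homStarModule θ a a; Module.Finite H (HomStar a a))
    {h : H} (hh : SetLike.IsHomogeneousElem 𝒜 h) :
    ∃ c : A, ∀ P : HomogeneousSpec 𝒜,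
      P ∈ supportVariety 𝒜 θ c ↔ P ∈ supportVariety 𝒜 θ a ∧ h ∈ P.ideal.toIdeal := by
  -- The square has even degree and is therefore central in `H`, as the Nakayama argument requires;
  -- primes containing `h` and `h²` are the same.
  have hmul : SetLike.IsHomogeneousElem 𝒜 (h * h) := hh.mul hh
  obtain ⟨d, hd⟩ := hmul
  obtain ⟨κ, hκ⟩ := hθ d _ hd
  obtain ⟨c, i, π, hT⟩ := Pretriangulated.distinguished_cocone_triangle (centralHom a κ)
  have hφ : ∀ (x : A) {t : H} {m : ℕ} {τ : GHom (𝟙_ C) (𝟙_ C) (m : ℤ)},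
      θ t = DirectSum.of (GHom (𝟙_ C) (𝟙_ C)) (m : ℤ) τ →
        (centralRingHom x).comp θ t = DirectSum.of (GHom x x) (m : ℤ) (centralHom x τ) := by
    intro x t m τ ht
    rw [RingHom.comp_apply, ht, centralRingHom_of]
  have hsq : ∀ {t : H} {m : ℕ} {τ : GHom (𝟙_ C) (𝟙_ C) (m : ℤ)},
      θ t = DirectSum.of (GHom (𝟙_ C) (𝟙_ C)) (m : ℤ) τ →
        (centralHom c τ).comp (centralHom c τ) rfl = 0 →
          t * t ∈ RingHom.ker ((centralRingHom c).comp θ) := by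
    intro t m τ ht h0
    rw [RingHom.mem_ker, map_mul, hφ c ht]
    refine (DirectSum.of_mul_of _ _).trans ?_
    exact (congrArg (DirectSum.of (GHom c c) ((m : ℤ) + m)) h0).trans (map_zero _)
  have hcomp : ∀ (x : A) {t : H} (m : ℕ), t ∈ RingHom.ker ((centralRingHom x).comp θ) →
      ∃ τ : GHom (𝟙_ C) (𝟙_ C) (m : ℤ),
        θ (DirectSum.decompose 𝒜 t m) = DirectSum.of (GHom (𝟙_ C) (𝟙_ C)) (m : ℤ) τ ∧
          centralHom x τ = 0 := by
    intro x t m ht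
    obtain ⟨τ, hτ⟩ := hθ m _ (SetLike.coe_mem (DirectSum.decompose 𝒜 t m))
    refine ⟨τ, hτ, DirectSum.of_injective (β := GHom x x) (m : ℤ) ?_⟩
    have h1 := centralRingHom_comp_apply_component hθ x t m
    rw [(RingHom.mem_ker).1 ht, hφ x hτ, DirectSum.zero_apply, map_zero] at h1
    exact h1.trans (map_zero _).symm
  refine ⟨c, fun P => ?_⟩
  have hprime := P.isPrime
  rw [mem_supportVariety_iff hθ, mem_supportVariety_iff hθ]
  refine ⟨fun hP => ⟨fun t ht => ?_, ?_⟩, fun ⟨hP, hhP⟩ t ht => ?_⟩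
  · refine mem_homogeneousIdeal_of_decompose_mem _ fun m => ?_
    obtain ⟨τ, hτ, h0⟩ := hcomp a m ht
    have h1 := hP (hsq hτ (centralHom_cone_of_eq_zero (Int.natCast_nonneg d) hT
      (Int.natCast_nonneg m) h0))
    exact (hprime.mem_or_mem h1).elim id id
  · have h1 := hP (hsq hκ (centralHom_cone_self (Int.natCast_nonneg d) κ hT))
    have h2 := (hprime.mem_or_mem h1).elim id id
    exact (hprime.mem_or_mem h2).elim id id
  · refine mem_homogeneousIdeal_of_decompose_mem _ fun m => ?_
    obtain ⟨τ, hτ, h0⟩ := hcomp c m ht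
    -- The quotient `w` has degree `m - d`, which may be negative; this is harmless because
    -- `End^*(a)` is graded by `ℤ`.
    obtain ⟨w, hw⟩ := exists_comp_centralHom_eq (Int.natCast_nonneg d) κ hT
      (Int.natCast_nonneg m) (add_sub_cancel (d : ℤ) m) h0
    have hw' : (centralRingHom a).comp θ (DirectSum.decompose 𝒜 t m) =
        (centralRingHom a).comp θ (h * h) * DirectSum.of (GHom a a) ((m : ℤ) - d) w := by
      rw [hφ a hτ, hφ a hκ]
      refine Eq.trans ?_ (DirectSum.of_mul_of _ _).symm
      refine DirectSum.of_eq_of_gradedMonoid_eq ?_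
      rw [← hw]
      exact (GHom.mk_comp_eq w (centralHom a κ) _ _)
    have hnoeth : letI := Module.compHom (EndStar a) ((centralRingHom a).comp θ);
        IsNoetherian H (EndStar a) := by
      have : Module.compHom (EndStar a) ((centralRingHom a).comp θ) = homStarModule θ a a :=
        Module.ext' _ _ fun r x => (homStarModule_smul_def θ a r x).symm
      rw [this]
      let := homStarModule θ a a
      exact isNoetherian_of_isNoetherianRing_of_finite H (HomStar a a)
    obtain ⟨k, j, hj⟩ := exists_pow_sub_mul_mem_ker _ hnoeth (GradedCommutative.sq_comm hh) hw'
    have h1 : (DirectSum.decompose 𝒜 t m : H) ^ k ∈ P.ideal.toIdeal := by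
      have := add_mem (hP hj) (Ideal.mul_mem_left _ j (Ideal.mul_mem_left _ h hhP))
      rwa [sub_add_cancel] at this
    exact hprime.mem_of_pow_mem k h1

theorem exists_supportVariety_eq_inter_finset [IsNoetherianRing H]
    {θ : H →+* EndStar (𝟙_ C : C)}
    (hθ : ∀ (n : ℕ), ∀ x ∈ 𝒜 n,
      ∃ h : GHom (𝟙_ C) (𝟙_ C) (n : ℤ), θ x = DirectSum.of (GHom (𝟙_ C) (𝟙_ C)) (n : ℤ) h)
    (hfin : ∀ a b : A, letI := homStarModule θ a b; Module.Finite H (HomStar a b))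
    (a : A) (S : Finset H) (hS : ∀ x ∈ S, SetLike.IsHomogeneousElem 𝒜 x) :
    ∃ c : A, ∀ P : HomogeneousSpec 𝒜, P ∈ supportVariety 𝒜 θ c ↔
      P ∈ supportVariety 𝒜 θ a ∧ ∀ x ∈ S, x ∈ P.ideal.toIdeal := by
  classical
  induction S using Finset.induction_on with
  | empty => exact ⟨a, fun P => by simp⟩
  | insert x S _ ih =>
    obtain ⟨b, hb⟩ := ih fun y hy => hS y (Finset.mem_insert_of_mem hy)
    obtain ⟨c, hc⟩ :=
      exists_supportVariety_eq_inter hθ b (hfin b b) (hS x (Finset.mem_insert_self x S))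
    refine ⟨c, fun P => ?_⟩
    rw [hc, hb, Finset.forall_mem_insert]
    tauto

end Realization

/-- A finitely generated homogeneous ideal is generated by finitely many homogeneous elements. -/
theorem exists_homogeneous_finset_span_eq {H : Type*} [Ring H] {𝒜 : ℕ → AddSubgroup H}
    [GradedRing 𝒜] (I : HomogeneousIdeal 𝒜) (hI : I.toIdeal.FG) :
    ∃ S : Finset H, (∀ x ∈ S, SetLike.IsHomogeneousElem 𝒜 x) ∧
      Ideal.span (S : Set H) = I.toIdeal := by
  classical
  obtain ⟨T, hT⟩ := hI
  refine ⟨T.biUnion fun t => (DirectSum.decompose 𝒜 t).support.image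
    fun n => (DirectSum.decompose 𝒜 t n : H), ?_, le_antisymm ?_ ?_⟩
  · simp only [Finset.mem_biUnion, Finset.mem_image]
    rintro x ⟨t, -, n, -, rfl⟩
    exact ⟨n, SetLike.coe_mem _⟩
  · rw [Ideal.span_le]
    intro x hx
    simp only [Finset.coe_biUnion, Finset.coe_image, Set.mem_iUnion, Set.mem_image] at hx
    obtain ⟨t, ht, n, -, rfl⟩ := hx
    exact I.isHomogeneous n (hT ▸ Submodule.subset_span ht)
  · rw [← hT, Submodule.span_le]
    intro t ht
    rw [← DirectSum.sum_support_decompose 𝒜 t]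
    refine sum_mem fun n hn => Ideal.subset_span ?_
    simp only [Finset.coe_biUnion, Finset.coe_image, Set.mem_iUnion, Set.mem_image]
    exact ⟨t, ht, n, hn, rfl⟩

theorem mainTheorem1
    -- a triangulated tensor category `C`
    {C : Type*} [Category* C] [Preadditive C] [HasZeroObject C] [HasShift C ℤ]
    [∀ n : ℤ, (shiftFunctor C n).Additive] [Pretriangulated C] [IsTriangulated C]
    [MonoidalCategory C] [TriangulatedTensorCategory C]
    -- acting on a triangulated category `A`
    {A : Type*} [Category* A] [Preadditive A] [HasZeroObject A] [HasShift A ℤ]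
    [∀ n : ℤ, (shiftFunctor A n).Additive] [Pretriangulated A] [IsTriangulated A]
    [MonoidalLeftAction C A] [TriangulatedAction C A]
    -- a positively graded, graded-commutative Noetherian ring `H`
    {H : Type*} [Ring H] (𝒜 : ℕ → AddSubgroup H) [GradedRing 𝒜] [GradedCommutative 𝒜]
    [IsNoetherianRing H]
    -- with a homomorphism of graded rings to `End^*_C(e)`
    (θ : H →+* EndStar (𝟙_ C : C))
    (hθ : ∀ (n : ℕ), ∀ x ∈ 𝒜 n,
      ∃ h : GHom (𝟙_ C) (𝟙_ C) (n : ℤ), θ x = DirectSum.of (GHom (𝟙_ C) (𝟙_ C)) (n : ℤ) h)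
    -- such that all `Hom^*_A(a, b)` are finitely generated
    (hfin : ∀ a b : A, letI := homStarModule θ a b; Module.Finite H (HomStar a b)) :
    (∀ (a : A) (I : HomogeneousIdeal 𝒜), zeroLocus I ⊆ supportVariety 𝒜 θ a →
      ∃ b : A, supportVariety 𝒜 θ b = zeroLocus I) ∧
    (∀ g : A, (ObjectProperty.singleton g).triangEnvelope = ⊤ →
      ∀ I : HomogeneousIdeal 𝒜, zeroLocus I ⊆ supportVariety 𝒜 θ g →
        ∃ b : A, supportVariety 𝒜 θ b = zeroLocus I) := by
  have key : ∀ (a : A) (I : HomogeneousIdeal 𝒜), zeroLocus I ⊆ supportVariety 𝒜 θ a →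
      ∃ b : A, supportVariety 𝒜 θ b = zeroLocus I := by
    intro a I hI
    obtain ⟨S, hS, hSI⟩ := exists_homogeneous_finset_span_eq I (IsNoetherian.noetherian I.toIdeal)
    obtain ⟨b, hb⟩ := exists_supportVariety_eq_inter_finset hθ hfin a S hS
    refine ⟨b, Set.ext fun P => ?_⟩
    have hP : P ∈ zeroLocus I ↔ ∀ x ∈ S, x ∈ P.ideal.toIdeal := by
      rw [mem_zeroLocus_iff, ← hSI, Ideal.span_le]
      rfl
    rw [hb, ← hP]
    exact ⟨fun h => h.2, fun h => ⟨hI h, h⟩⟩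
  -- Part (b) is the case `a = g` of part (a).
  exact ⟨key, fun g _ => key g⟩
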